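/- Let $\Omega\subset\mathbb{R}^n$ be a convex set such that, whenever $x=\lambda_1x_1+\cdots+\lambda_kx_k$ with $\lambda_i\ge 0$, $\sum_i\lambda_i=1$, $x_i,x\in\Omega$ and $x_i\neq x$ for all $i$, the point $x$ lies in the relative interior of $\Omega$. Let $A\subset\mathbb{R}^n$ be a set such that $A\cap\Omega$ is closed in $\Omega$ (for instance, a closed set $A$) and $\dim (A\cap\Omega)\le\dim\Omega-2$; here $\dim\Omega$ is the dimension of the affine hull of $\Omega$, and $\dim(A\cap\Omega)$ is the Hausdorff dimension, with $\dim\emptyset=-\infty$. For a set $S\subset\mathbb{R}^n$ and a function $f:S\to\mathbb{R}$, call $f$ - convex on $S$ if $f(x)\le\lambda_1f(x_1)+\cdots+\lambda_kf(x_k)$ whenever $x_1,\dots,x_k\in S$ and $x=\lambda_1x_1+\cdots+\lambda_kx_k\in S$ with $\lambda_i\ge0$, $\sum_i\lambda_i=1$; - locally convex on $S$ if every $x\in S$ is the centre of a ball $B$ such that $f|_{B\cap S}$ is convex on $B\cap S$; - interval convex on $S$ if the restriction of $f$ to every straight line segment contained in $S$ is convex. The strict versions are obtained by requiring, throughout,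 strict inequality when $x_i\ne x$ for all $i$. Then for every function $f:\Omega\setminus A\to\mathbb{R}$ (no continuity is assumed), convexity, local convexity and interval convexity of $f$ on $\Omega\setminus A$ are equivalent. Likewise, strict convexity, strict local convexity and strict interval convexity of $f$ on $\Omega\setminus A$ are equivalent. -/

import Mathlib

/-- `x = w₁ y₁ + ⋯ + w_k y_k` with `w_i ≥ 0` and `w₁ + ⋯ + w_k = 1`. -/
def IsConvexCombination {n k : ℕ} (x : EuclideanSpace ℝ (Fin n))
    (y : Fin k → EuclideanSpace ℝ (Fin n)) (w : Fin k → ℝ) : Prop :=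
  (∀ i, 0 ≤ w i) ∧ ∑ i, w i = 1 ∧ x = ∑ i, w i • y i

/-- Convexity of `f` on an arbitrary (not necessarily convex) set `S`: Jensen's inequality for all
convex combinations of points of `S` that lie in `S`. Only the values of `f` on `S` matter. -/
def ConvexFunOn {n : ℕ} (S : Set (EuclideanSpace ℝ (Fin n)))
    (f : EuclideanSpace ℝ (Fin n) → ℝ) : Prop :=
  ∀ (k : ℕ) (x : EuclideanSpace ℝ (Fin n)) (y : Fin k → EuclideanSpace ℝ (Fin n))
    (w : Fin k → ℝ), IsConvexCombination x y w → (∀ i, y i ∈ S) → x ∈ S →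
    f x ≤ ∑ i, w i * f (y i)

/-- Strict convexity on an arbitrary set: the inequality is strict when all `y i ≠ x`. -/
def StrictConvexFunOn {n : ℕ} (S : Set (EuclideanSpace ℝ (Fin n)))
    (f : EuclideanSpace ℝ (Fin n) → ℝ) : Prop :=
  ∀ (k : ℕ) (x : EuclideanSpace ℝ (Fin n)) (y : Fin k → EuclideanSpace ℝ (Fin n))
    (w : Fin k → ℝ), IsConvexCombination x y w → (∀ i, y i ∈ S) → x ∈ S →
    (∀ i, y i ≠ x) → f x < ∑ i, w i * f (y i)

/-- Every point of `S` is the centre of a ball `B` such that `f` is convex on `B ∩ S`. -/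
def LocallyConvexFunOn {n : ℕ} (S : Set (EuclideanSpace ℝ (Fin n)))
    (f : EuclideanSpace ℝ (Fin n) → ℝ) : Prop :=
  ∀ x ∈ S, ∃ r : ℝ, 0 < r ∧ ConvexFunOn (Metric.ball x r ∩ S) f

/-- Every point of `S` is the centre of a ball `B` such that `f` is strictly convex on `B ∩ S`. -/
def StrictLocallyConvexFunOn {n : ℕ} (S : Set (EuclideanSpace ℝ (Fin n)))
    (f : EuclideanSpace ℝ (Fin n) → ℝ) : Prop :=
  ∀ x ∈ S, ∃ r : ℝ, 0 < r ∧ StrictConvexFunOn (Metric.ball x r ∩ S) f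

/-- `f` is convex on every straight line segment contained in `S`. -/
def IntervalConvexFunOn {n : ℕ} (S : Set (EuclideanSpace ℝ (Fin n)))
    (f : EuclideanSpace ℝ (Fin n) → ℝ) : Prop :=
  ∀ a b : EuclideanSpace ℝ (Fin n), segment ℝ a b ⊆ S → ConvexFunOn (segment ℝ a b) f

/-- `f` is strictly convex on every straight line segment contained in `S`. -/
def StrictIntervalConvexFunOn {n : ℕ} (S : Set (EuclideanSpace ℝ (Fin n)))
    (f : EuclideanSpace ℝ (Fin n) → ℝ) : Prop :=
  ∀ a b : EuclideanSpace ℝ (Fin n), segment ℝ a b ⊆ S → StrictConvexFunOn (segment ℝ a b) f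

/-- `dim A ≤ dim Ω - 2`, where `dim A` is the Hausdorff dimension, with the convention
`dim ∅ = -∞` (Mathlib's `dimH ∅` is `0`), and the dimension of the convex set `Ω` is the dimension
of its affine hull. -/
def DimLeDimSubTwo {n : ℕ} (A Ω : Set (EuclideanSpace ℝ (Fin n))) : Prop :=
  A = ∅ ∨ dimH A + 2 ≤ (Module.finrank ℝ (affineSpan ℝ Ω).direction : ENNReal)

/-- Whenever `x ∈ Ω` is a convex combination of points of `Ω` that are all different from `x`,
the point `x` lies in the relative interior of `Ω`. -/
def CombinationsInRelInterior {n : ℕ} (Ω : Set (EuclideanSpace ℝ (Fin n))) : Prop :=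
  ∀ (k : ℕ) (x : EuclideanSpace ℝ (Fin n)) (y : Fin k → EuclideanSpace ℝ (Fin n))
    (w : Fin k → ℝ), IsConvexCombination x y w → (∀ i, y i ∈ Ω) → x ∈ Ω →
    (∀ i, y i ≠ x) → x ∈ intrinsicInterior ℝ Ω

open Set Filter Topology

/-! Everything reduces to two-point convexity along segments missing A, `SegmentConvexOn`. Interval
convexity gives it at once; local convexity gives it by gluing overlapping intervals.

To pass to Jensen's inequality, note that interior points have a ball inside the domain, where f is
convex and hence continuous. A set of codimension at least two projects along a line onto a set with
dense complement, so a segment can be moved off it by arbitrarily small translations; continuity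
returns the inequality to the original points. Induction gives k points. Points on the boundary,
where f may be discontinuous, are approached along segments towards x, using upper bounds only. The
hypothesis on Ω puts every nontrivial barycentre x in the relative interior, as this argument needs.
Strictness is a local matter at x, recovered by contracting the points towards x. -/

/-! ### Gluing convex functions of one variable. -/

lemma ConvexOn.of_inter_Iic_of_inter_Ici {C : Set ℝ} {g : ℝ → ℝ} {p q : ℝ} (hC : Convex ℝ C)
    (hpq : p < q) (h₁ : ConvexOn ℝ (C ∩ Iic q) g) (h₂ : ConvexOn ℝ (C ∩ Ici p) g) :
    ConvexOn ℝ C g := by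
  have key : ∀ {D : Set ℝ}, ConvexOn ℝ D g → ∀ {x y z : ℝ}, x ∈ D → z ∈ D → x ≤ y → y ≤ z →
      (z - x) * g y ≤ (z - y) * g x + (y - x) * g z := by
    intro D hD x y z hx hz hxy hyz
    rcases hxy.eq_or_lt with rfl | hxy
    · linarith
    rcases hyz.eq_or_lt with rfl | hyz
    · linarith
    have hne : z - x ≠ 0 := by linarith
    have := hD.2 hx hz (show 0 ≤ (z - y) / (z - x) from div_nonneg (by linarith) (by linarith))
      (show 0 ≤ (y - x) / (z - x) from div_nonneg (by linarith) (by linarith))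
      (by field_simp; ring)
    have e : (z - y) / (z - x) * x + (y - x) / (z - x) * z = y := by field_simp; ring
    simp only [smul_eq_mul] at this
    rw [e] at this
    have h3 := mul_le_mul_of_nonneg_left this (show 0 ≤ z - x by linarith)
    have e2 : (z - x) * ((z - y) / (z - x) * g x + (y - x) / (z - x) * g z) =
      (z - y) * g x + (y - x) * g z := by field_simp
    linarith
  refine LinearOrder.convexOn_of_lt hC ?_
  intro x hx z hz hxz a b ha hb hab
  have hmem : ∀ y, x ≤ y → y ≤ z → y ∈ C := fun y h h' => hC.ordConnected.out hx hz ⟨h, h'⟩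
  rcases le_or_gt z q with hzq | hzq
  · exact h₁.2 ⟨hx, hxz.le.trans hzq⟩ ⟨hz, hzq⟩ ha.le hb.le hab
  rcases le_or_gt p x with hpx | hpx
  · exact h₂.2 ⟨hx, hpx⟩ ⟨hz, hpx.trans hxz.le⟩ ha.le hb.le hab
  have hp : p ∈ C := hmem p hpx.le (by linarith)
  have hq : q ∈ C := hmem q (by linarith) hzq.le
  -- the chord from `x` to `z`, scaled by `z - x`
  set L : ℝ → ℝ := fun y => (z - x) * g y - ((z - y) * g x + (y - x) * g z) with hL
  -- `L` is a positive multiple of `g` plus an affine function and vanishes at `x` and `z`, so it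
  -- inherits convexity on both pieces.
  have k₁ : ∀ y, x ≤ y → y ≤ q → (q - x) * L y ≤ (y - x) * L q := by
    intro y h h'
    have := key h₁ (y := y) ⟨hx, by simp; linarith⟩ ⟨hq, by simp⟩ h h'
    simp only [hL]
    nlinarith
  have k₂ : ∀ y, p ≤ y → y ≤ z → (z - p) * L y ≤ (z - y) * L p := by
    intro y h h'
    have := key h₂ (y := y) ⟨hp, by simp⟩ ⟨hz, by simp; linarith⟩ h h'
    simp only [hL]
    nlinarith
  -- If `L p > 0`, convexity on the left piece forces `L q > L p`, and on the right piece `L q < L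
  -- p`.
  have hLp : L p ≤ 0 := by
    have a₁ := k₁ p hpx.le hpq.le
    have a₂ := k₂ q hpq.le hzq.le
    by_contra! hpos
    have b₁ : L p < L q := by
      have : (p - x) * L p < (p - x) * L q := by nlinarith
      exact lt_of_mul_lt_mul_left this (by linarith)
    nlinarith
  have hLq : L q ≤ 0 := by
    have a₂ := k₂ q hpq.le hzq.le
    by_contra! hpos
    nlinarith
  have hLy : ∀ y, x ≤ y → y ≤ z → L y ≤ 0 := by
    intro y h h'
    rcases le_total y q with hy | hy
    · have := k₁ y h hy
      by_contra! hpos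
      nlinarith
    · have := k₂ y (by linarith) h'
      by_contra! hpos
      nlinarith
  have hb' := mul_pos hb (sub_pos.2 hxz)
  have ha' := mul_pos ha (sub_pos.2 hxz)
  obtain rfl : a = 1 - b := by linarith
  have hfin := hLy ((1 - b) * x + b * z) (by linarith) (by linarith)
  simp only [hL, smul_eq_mul] at hfin ⊢
  have e : (z - ((1 - b) * x + b * z)) * g x + ((1 - b) * x + b * z - x) * g z =
      (z - x) * ((1 - b) * g x + b * g z) := by ring
  rw [e] at hfin
  exact le_of_mul_le_mul_left (by linarith) (sub_pos.2 hxz)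

lemma convexOn_Icc_zero_one_of_locally {g : ℝ → ℝ}
    (h : ∀ t ∈ Icc (0 : ℝ) 1, ∃ W : Set ℝ, IsOpen W ∧ t ∈ W ∧
      ∀ I, Convex ℝ I → I ⊆ Icc 0 1 ∩ W → ConvexOn ℝ I g) : ConvexOn ℝ (Icc 0 1) g := by
  choose! W hWo hWt hW using h
  obtain ⟨δ, hδ, hcov⟩ := lebesgue_number_lemma_of_metric (isCompact_Icc (a := (0 : ℝ)) (b := 1))
    (c := fun t : Icc (0 : ℝ) 1 => W t) (fun t => hWo t t.2)
    (fun t ht => mem_iUnion.2 ⟨⟨t, ht⟩, hWt t ht⟩)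
  have hball : ∀ x ∈ Icc (0 : ℝ) 1, ∀ I, Convex ℝ I → I ⊆ Icc 0 1 → I ⊆ Metric.ball x δ →
      ConvexOn ℝ I g := by
    intro x hx I hI h1 h2
    obtain ⟨i, hi⟩ := hcov x hx
    exact hW i i.2 I hI (subset_inter h1 (h2.trans hi))
  have step : ∀ n : ℕ, ConvexOn ℝ (Icc 0 1 ∩ Iic (n * (δ / 2))) g := by
    intro n
    induction n with
    | zero =>
      refine hball 0 (by simp) _ ((convex_Icc 0 1).inter (convex_Iic _)) inter_subset_left ?_
      rintro t ⟨⟨h0, -⟩, h1⟩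
      have : t = 0 := le_antisymm (by simpa using h1) h0
      simpa [this] using hδ
    | succ n ih =>
      rcases lt_or_ge 1 (n * (δ / 2)) with h1 | h1
      · exact ih.subset (fun t ht => ⟨ht.1, ht.1.2.trans h1.le⟩)
          ((convex_Icc 0 1).inter (convex_Iic _))
      -- Steps of `δ / 2` keep the new piece, overlap included, within `δ / 2` of its centre `n * (δ
      -- / 2)`, hence in the open `δ`-ball.
      refine ConvexOn.of_inter_Iic_of_inter_Ici (p := n * (δ / 2) - δ / 2) (q := n * (δ / 2))
        ((convex_Icc 0 1).inter (convex_Iic _)) (by linarith)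
        (ih.subset (fun t ht => ⟨ht.1.1, ht.2⟩)
          (((convex_Icc 0 1).inter (convex_Iic _)).inter (convex_Iic _))) ?_
      refine hball (n * (δ / 2)) ⟨by positivity, h1⟩ _
        (((convex_Icc 0 1).inter (convex_Iic _)).inter (convex_Ici _))
        (fun t ht => ht.1.1) ?_
      rintro t ⟨⟨-, ht⟩, ht'⟩
      simp only [mem_Iic, mem_Ici] at ht ht'
      push_cast at ht
      rw [Metric.mem_ball, Real.dist_eq, abs_lt]
      constructor <;> linarith
  obtain ⟨n, hn⟩ := exists_nat_ge (1 / (δ / 2))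
  refine (step n).subset (fun t ht => ⟨ht, ht.2.trans ?_⟩) (convex_Icc 0 1)
  rwa [div_le_iff₀ (by positivity)] at hn

/-! ### Convexity along segments. -/

section Segments

variable {E : Type*} [NormedAddCommGroup E] [InnerProductSpace ℝ E]

/-- Two-point convexity of `f` along every segment contained in `S`. -/
def SegmentConvexOn (S : Set E) (f : E → ℝ) : Prop :=
  ∀ a b : E, segment ℝ a b ⊆ S → ∀ s t : ℝ, 0 ≤ s → 0 ≤ t → s + t = 1 →
    f (s • a + t • b) ≤ s * f a + t * f b

lemma SegmentConvexOn.convexOn {S C : Set E} {f : E → ℝ} (hf : SegmentConvexOn S f)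
    (hC : Convex ℝ C) (hCS : C ⊆ S) : ConvexOn ℝ C f :=
  ⟨hC, fun _ ha _ hb s t hs ht hst =>
    hf _ _ ((hC.segment_subset ha hb).trans hCS) s t hs ht hst⟩

lemma SegmentConvexOn.of_locally {S : Set E} {f : E → ℝ}
    (h : ∀ x ∈ S, ∃ r > 0, ∀ C, Convex ℝ C → C ⊆ Metric.ball x r ∩ S → ConvexOn ℝ C f) :
    SegmentConvexOn S f := by
  intro a b hab s t hs ht hst
  have hmem : ∀ u ∈ Icc (0 : ℝ) 1, AffineMap.lineMap a b u ∈ S := fun u hu =>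
    hab (segment_eq_image_lineMap ℝ a b ▸ mem_image_of_mem _ hu)
  have hg : ConvexOn ℝ (Icc 0 1) (f ∘ AffineMap.lineMap (k := ℝ) a b) := by
    refine convexOn_Icc_zero_one_of_locally fun u hu => ?_
    obtain ⟨r, hr, hC⟩ := h _ (hmem u hu)
    refine ⟨AffineMap.lineMap (k := ℝ) a b ⁻¹' Metric.ball (AffineMap.lineMap a b u) r,
      Metric.isOpen_ball.preimage AffineMap.lineMap_continuous, by simpa using hr, ?_⟩
    intro I hI hIW
    refine ((hC (AffineMap.lineMap (k := ℝ) a b '' I) (hI.affine_image _) ?_).comp_affineMap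
      (AffineMap.lineMap (k := ℝ) a b)).subset (subset_preimage_image _ _) hI
    rintro _ ⟨v, hv, rfl⟩
    exact ⟨(hIW hv).2, hmem v (hIW hv).1⟩
  have := hg.2 (x := 0) (y := 1) (by simp) (by simp) hs ht hst
  obtain rfl : s = 1 - t := by linarith
  simpa [AffineMap.lineMap_apply_module] using this

/-! ### Jensen's inequality off a set of codimension two. -/

variable [FiniteDimensional ℝ E]

lemma SegmentConvexOn.continuousAt {S : Set E} {f : E → ℝ} (hf : SegmentConvexOn S f) {x : E}
    (hx : S ∈ 𝓝 x) : ContinuousAt f x := by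
  obtain ⟨r, hr, hrS⟩ := Metric.mem_nhds_iff.1 hx
  exact ((hf.convexOn (convex_ball x r) hrS).continuousOn Metric.isOpen_ball).continuousAt
    (Metric.ball_mem_nhds x hr)

/-- Codimension at least two, where the empty set has dimension `-∞`. -/
def CodimTwoLe (B : Set E) : Prop :=
  B = ∅ ∨ dimH B + 2 ≤ (Module.finrank ℝ E : ENNReal)

/-- Projection orthogonal to `b - a` collapses the whole line to a point and does not raise the
dimension of `B`, which stays below that of the target. The image of `B` therefore has dense
complement. -/
lemma CodimTwoLe.frequently_disjoint_segment {B : Set E} (hB : CodimTwoLe B) (a b : E) :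
    ∃ᶠ v in 𝓝 (0 : E), ∀ s t : ℝ, s + t = 1 → s • (a + v) + t • (b + v) ∉ B := by
  rcases hB with rfl | hB
  · simp
  set L : Submodule ℝ E := Submodule.span ℝ {b - a}
  set P := Lᗮ.orthogonalProjectionOnto
  have hfin : dimH (P '' B) < Module.finrank ℝ Lᗮ := by
    have h1 : dimH (P '' B) ≤ dimH B :=
      Lᗮ.lipschitzWith_orthogonalProjectionOnto.dimH_image_le B
    have h2 : Module.finrank ℝ L ≤ 1 := by
      simpa using finrank_span_le_card (R := ℝ) ({b - a} : Set E)
    have h3 := L.finrank_add_finrank_orthogonal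
    have h4 : Module.finrank ℝ E ≤ Module.finrank ℝ Lᗮ + 1 := by omega
    have h5 : dimH B + 1 + 1 ≤ (Module.finrank ℝ Lᗮ : ENNReal) + 1 := by
      rw [add_assoc, one_add_one_eq_two]
      exact hB.trans (by exact_mod_cast h4)
    have h6 := (ENNReal.add_le_add_iff_right ENNReal.one_ne_top).1 h5
    have h7 : dimH B ≠ ⊤ := fun h => by simp [h] at h6
    exact h1.trans_lt ((ENNReal.lt_add_right h7 one_ne_zero).trans_le h6)
  have hdense := dense_compl_of_dimH_lt_finrank hfin
  rw [frequently_iff]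
  intro U hU
  have hV : (fun v : Lᗮ => (v : E)) ⁻¹' U ∈ 𝓝 (0 : Lᗮ) :=
    continuous_subtype_val.continuousAt (by simpa using hU)
  have hV' : (fun v : Lᗮ => v - P a) ⁻¹' ((fun v : Lᗮ => (v : E)) ⁻¹' U) ∈ 𝓝 (P a) :=
    (continuous_sub_right (P a)).continuousAt (by simpa using hV)
  obtain ⟨w, hwB, hw⟩ := hdense.inter_nhds_nonempty hV'
  -- This translation moves the projection of the line from `P a` to `w`, a point outside `P '' B`.
  refine ⟨((w - P a : Lᗮ) : E), hw, fun s t hst hmem => hwB ⟨_, hmem, ?_⟩⟩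
  obtain rfl : s = 1 - t := by linarith
  have h0 : P (b - a) = 0 := Submodule.orthogonalProjectionOnto_orthogonalComplement_singleton_eq_zero _
  have h1 : P ((w - P a : Lᗮ) : E) = w - P a :=
    Submodule.orthogonalProjectionOnto_mem_subspace_eq_self _
  have e : (1 - t) • (a + ((w - P a : Lᗮ) : E)) + t • (b + ((w - P a : Lᗮ) : E)) =
      a + ((w - P a : Lᗮ) : E) + t • (b - a) := by module
  rw [e, map_add, map_add, map_smul, h0, h1]
  simp

lemma SegmentConvexOn.jensen_two_of_isOpen {U O : Set E} {f : E → ℝ} (hU : IsOpen U)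
    (hUc : Convex ℝ U) (hO : IsOpen O) (hB : CodimTwoLe (U \ O)) (hf : SegmentConvexOn (U ∩ O) f)
    {a b : E} (ha : a ∈ U ∩ O) (hb : b ∈ U ∩ O) {s t : ℝ} (hs : 0 ≤ s) (ht : 0 ≤ t)
    (hst : s + t = 1) (hx : s • a + t • b ∈ U ∩ O) : f (s • a + t • b) ≤ s * f a + t * f b := by
  have hS := hU.inter hO
  have hcont : ∀ {z}, z ∈ U ∩ O → Tendsto (fun v => f (z + v)) (𝓝 0) (𝓝 (f z)) := by
    intro z hz
    have h1 : Tendsto (fun v => z + v) (𝓝 0) (𝓝 z) :=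
      (continuous_const_add z).tendsto' _ _ (add_zero z)
    exact (hf.continuousAt (hS.mem_nhds hz)).tendsto.comp h1
  have hmem : ∀ {z}, z ∈ U → ∀ᶠ v in 𝓝 (0 : E), z + v ∈ U := by
    intro z hz
    exact ((continuous_const_add z).tendsto' 0 z (add_zero z)).eventually (hU.mem_nhds hz)
  refine le_of_tendsto_of_tendsto_of_frequently (hcont hx)
    (((hcont ha).const_mul s).add ((hcont hb).const_mul t)) ?_
  refine ((hB.frequently_disjoint_segment a b).and_eventually
    ((hmem ha.1).and (hmem hb.1))).mono ?_
  rintro v ⟨hv, hav, hbv⟩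
  have e : s • a + t • b + v = s • (a + v) + t • (b + v) := by
    rw [smul_add, smul_add, add_add_add_comm, ← add_smul, hst, one_smul]
  rw [e]
  refine hf _ _ ?_ s t hs ht hst
  rintro _ ⟨p, q, hp, hq, hpq, rfl⟩
  have hU' := hUc hav hbv hp hq hpq
  exact ⟨hU', by_contra fun h => hv p q hpq ⟨hU', h⟩⟩

/-- Induction on `k`: the barycentre `z` of all points but the first may lie in the removed set.
Shifting those points by a small `v` moves `z` off it, while the total barycentre moves by `c • v`;
then `v` tends to zero. -/
lemma SegmentConvexOn.jensen_of_isOpen {U O : Set E} {f : E → ℝ} (hU : IsOpen U)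
    (hUc : Convex ℝ U) (hO : IsOpen O) (hB : CodimTwoLe (U \ O)) (hf : SegmentConvexOn (U ∩ O) f)
    {k : ℕ} {y : Fin k → E} {w : Fin k → ℝ} (hy : ∀ i, y i ∈ U ∩ O) (hw : ∀ i, 0 ≤ w i)
    (hw1 : ∑ i, w i = 1) (hx : ∑ i, w i • y i ∈ U ∩ O) :
    f (∑ i, w i • y i) ≤ ∑ i, w i * f (y i) := by
  induction k with
  | zero => simp at hw1
  | succ k ih =>
    rw [Fin.sum_univ_succ] at hw1 hx ⊢
    rw [Fin.sum_univ_succ]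
    set c := ∑ i : Fin k, w i.succ with hc
    have hc0 : 0 ≤ c := Finset.sum_nonneg fun i _ => hw _
    rcases hc0.eq_or_lt with h0 | hcpos
    · have hz : ∀ i : Fin k, w i.succ = 0 := by
        intro i
        exact (Finset.sum_eq_zero_iff_of_nonneg (fun i _ => hw _)).1 h0.symm i (Finset.mem_univ i)
      have h1 : w 0 = 1 := by linarith
      simp [hz, h1]
    have hw' : ∀ i : Fin k, 0 ≤ w i.succ / c := fun i => div_nonneg (hw _) hc0
    have hw1' : ∑ i : Fin k, w i.succ / c = 1 := by
      rw [← Finset.sum_div, ← hc, div_self hcpos.ne']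
    set z := ∑ i : Fin k, (w i.succ / c) • y i.succ with hz
    have hzc : c • z = ∑ i : Fin k, w i.succ • y i.succ := by
      rw [hz, Finset.smul_sum]
      refine Finset.sum_congr rfl fun i _ => ?_
      rw [smul_smul, mul_div_cancel₀ _ hcpos.ne']
    rw [← hzc] at hx ⊢
    have hS := hU.inter hO
    have htend : ∀ (p : E) (r : ℝ), Tendsto (fun v : E => p + r • v) (𝓝 0) (𝓝 p) := fun p r =>
      Continuous.tendsto' (by fun_prop) _ _ (by simp)
    have hcont : ∀ {p}, p ∈ U ∩ O → ∀ r : ℝ,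
        Tendsto (fun v => f (p + r • v)) (𝓝 0) (𝓝 (f p)) := fun hp r =>
      (hf.continuousAt (hS.mem_nhds hp)).tendsto.comp (htend _ r)
    have hzU : z ∈ U := hUc.sum_mem (fun i _ => hw' i) hw1' fun i _ => (hy _).1
    have hlim : Tendsto (fun v => w 0 * f (y 0) + ∑ i : Fin k, w i.succ * f (y i.succ + (1 : ℝ) • v))
        (𝓝 0) (𝓝 (w 0 * f (y 0) + ∑ i : Fin k, w i.succ * f (y i.succ))) :=
      tendsto_const_nhds.add (tendsto_finsetSum _ fun i _ => (hcont (hy _) 1).const_mul _)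
    refine le_of_tendsto_of_tendsto_of_frequently (hcont hx c) hlim ?_
    have hy' : ∀ᶠ v in 𝓝 (0 : E), ∀ i : Fin k, y i.succ + (1 : ℝ) • v ∈ U ∩ O :=
      eventually_all.2 fun i => (htend _ 1).eventually (hS.mem_nhds (hy _))
    -- The degenerate segment from `z` to `z` only asks that `z + v` avoid the removed set.
    refine ((hB.frequently_disjoint_segment z z).and_eventually
      (((htend z 1).eventually (hU.mem_nhds hzU)).and
        (((htend _ c).eventually (hS.mem_nhds hx)).and hy'))).mono ?_
    rintro v ⟨hv, hzv, hxv, hyv⟩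
    rw [one_smul] at hzv
    have hzv' : z + v ∈ U ∩ O := ⟨hzv, by_contra fun h => hv 1 0 (by simp) (by simpa using ⟨hzv, h⟩)⟩
    have hsum : ∑ i : Fin k, (w i.succ / c) • (y i.succ + (1 : ℝ) • v) = z + v := by
      simp only [one_smul, smul_add, Finset.sum_add_distrib]
      rw [← hz, ← Finset.sum_smul, hw1', one_smul]
    have h1 := ih hyv hw' hw1' (by rwa [hsum])
    rw [hsum] at h1
    have e : w 0 • y 0 + c • z + c • v = w 0 • y 0 + c • (z + v) := by rw [smul_add, add_assoc]
    rw [e] at hxv ⊢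
    have h2 := hf.jensen_two_of_isOpen hU hUc hO hB (hy 0) hzv' (hw 0) hc0 hw1 hxv
    have h3 := mul_le_mul_of_nonneg_left h1 hc0
    have h4 : c * ∑ i : Fin k, w i.succ / c * f (y i.succ + (1 : ℝ) • v) =
        ∑ i : Fin k, w i.succ * f (y i.succ + (1 : ℝ) • v) := by
      rw [Finset.mul_sum]
      refine Finset.sum_congr rfl fun i _ => ?_
      rw [← mul_assoc, mul_div_cancel₀ _ hcpos.ne']
    linarith

/-- Moving every `y i` the same fraction `u` towards `x` keeps the barycentre and brings all points
into the interior, where the open case applies. -/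
lemma SegmentConvexOn.jensen_of_mem_interior {Ω O : Set E} {f : E → ℝ} (hΩ : Convex ℝ Ω)
    (hO : IsOpen O) (hB : CodimTwoLe (Ω \ O)) (hf : SegmentConvexOn (Ω ∩ O) f)
    {k : ℕ} {y : Fin k → E} {w : Fin k → ℝ} (hy : ∀ i, y i ∈ Ω ∩ O) (hw : ∀ i, 0 ≤ w i)
    (hw1 : ∑ i, w i = 1) (hx : ∑ i, w i • y i ∈ interior Ω ∩ O) :
    f (∑ i, w i • y i) ≤ ∑ i, w i * f (y i) := by
  set x := ∑ i, w i • y i with hxdef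
  have hB' : CodimTwoLe (interior Ω \ O) := by
    have hsub : interior Ω \ O ⊆ Ω \ O := sdiff_subset_sdiff_left interior_subset
    rcases hB with hB | hB
    · exact Or.inl (subset_empty_iff.1 (hB ▸ hsub))
    · exact Or.inr (le_trans (by gcongr) hB)
  have hf' : SegmentConvexOn (interior Ω ∩ O) f := fun a b hab =>
    hf a b (hab.trans (inter_subset_inter_left _ interior_subset))
  -- points close to `y i` on the segment towards `x`
  have hnear : ∀ i, ∃ r > 0, r ≤ 1 ∧ ∀ u ∈ Icc (0 : ℝ) r, AffineMap.lineMap (y i) x u ∈ O := by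
    intro i
    have h1 : AffineMap.lineMap (k := ℝ) (y i) x ⁻¹' O ∈ 𝓝 (0 : ℝ) :=
      AffineMap.lineMap_continuous.continuousAt (by simpa using hO.mem_nhds (hy i).2)
    obtain ⟨r, hr, hrO⟩ := Metric.mem_nhds_iff.1 h1
    refine ⟨min (r / 2) 1, by positivity, min_le_right _ _, fun u hu => hrO ?_⟩
    have := hu.2.trans (min_le_left _ _)
    rw [Metric.mem_ball, Real.dist_eq, sub_zero, abs_of_nonneg hu.1]
    linarith
  choose r hr0 hr1 hrO using hnear
  have hint : ∀ i, ∀ u ∈ Ioc (0 : ℝ) 1, AffineMap.lineMap (y i) x u ∈ interior Ω := by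
    intro i u hu
    have := hΩ.combo_self_interior_mem_interior (hy i).1 hx.1 (a := 1 - u) (b := u)
      (by linarith [hu.2]) hu.1 (by ring)
    simpa [AffineMap.lineMap_apply_module] using this
  have hconv : ∀ i, ConvexOn ℝ (Icc 0 (r i)) (f ∘ AffineMap.lineMap (k := ℝ) (y i) x) := by
    intro i
    have hC : ConvexOn ℝ (AffineMap.lineMap (k := ℝ) (y i) x '' Icc 0 (r i)) f := by
      refine hf.convexOn ((convex_Icc _ _).affine_image _) ?_
      rintro _ ⟨u, hu, rfl⟩
      refine ⟨?_, hrO i u hu⟩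
      rcases hu.1.eq_or_lt with rfl | h0
      · simpa using (hy i).1
      · exact interior_subset (hint i u ⟨h0, hu.2.trans (hr1 i)⟩)
    exact (hC.comp_affineMap _).subset (subset_preimage_image _ _) (convex_Icc _ _)
  -- Continuity at `y i` may fail, but the chord bounds `f` from above and tends to `f (y i)` as `u`
  -- tends to zero.
  have hbound : ∀ i, ∀ u ∈ Icc (0 : ℝ) (r i), f (AffineMap.lineMap (y i) x u) ≤
      (1 - u / r i) * f (y i) + u / r i * f (AffineMap.lineMap (y i) x (r i)) := by
    intro i u hu
    have h1 := (hconv i).2 (x := 0) (y := r i) ⟨le_rfl, (hr0 i).le⟩ ⟨(hr0 i).le, le_rfl⟩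
      (show 0 ≤ 1 - u / r i by rw [sub_nonneg, div_le_one (hr0 i)]; exact hu.2)
      (show 0 ≤ u / r i from div_nonneg hu.1 (hr0 i).le) (by ring)
    simpa [(hr0 i).ne'] using h1
  have hlim : Tendsto (fun u : ℝ => ∑ i, w i *
      ((1 - u / r i) * f (y i) + u / r i * f (AffineMap.lineMap (y i) x (r i))))
      (𝓝[>] 0) (𝓝 (∑ i, w i * f (y i))) := by
    refine (Continuous.tendsto' ?_ _ _ ?_).mono_left nhdsWithin_le_nhds
    · fun_prop
    · simp
  refine ge_of_tendsto hlim ?_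
  have hev : ∀ᶠ u in 𝓝[>] (0 : ℝ), ∀ i, u ∈ Ioc 0 (r i) :=
    eventually_all.2 fun i => Ioc_mem_nhdsGT (hr0 i)
  filter_upwards [hev] with u hu
  have hsum : ∑ i, w i • AffineMap.lineMap (y i) x u = x := by
    have : ∀ i, w i • AffineMap.lineMap (y i) x u =
        (1 - u) • (w i • y i) + w i • (u • x) := fun i => by
      rw [AffineMap.lineMap_apply_module]; module
    simp only [this, Finset.sum_add_distrib, ← Finset.smul_sum, ← Finset.sum_smul, hw1]
    rw [← hxdef]; module
  have hyu : ∀ i, AffineMap.lineMap (y i) x u ∈ interior Ω ∩ O := fun i =>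
    ⟨hint i u ⟨(hu i).1, (hu i).2.trans (hr1 i)⟩, hrO i u ⟨(hu i).1.le, (hu i).2⟩⟩
  have h1 := hf'.jensen_of_isOpen isOpen_interior hΩ.interior hO hB' hyu hw hw1 (by rwa [hsum])
  rw [hsum] at h1
  exact h1.trans (Finset.sum_le_sum fun i _ =>
    mul_le_mul_of_nonneg_left (hbound i u ⟨(hu i).1.le, (hu i).2⟩) (hw i))

end Segments

/-! ### Relative interior, and the passage to strict convexity. -/

section Transfer

variable {n : ℕ} {f : EuclideanSpace ℝ (Fin n) → ℝ} {S : Set (EuclideanSpace ℝ (Fin n))}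

lemma IsConvexCombination.two {x y : EuclideanSpace ℝ (Fin n)} {s t : ℝ} (hs : 0 ≤ s)
    (ht : 0 ≤ t) (hst : s + t = 1) : IsConvexCombination (s • x + t • y) ![x, y] ![s, t] :=
  ⟨by simp [Fin.forall_fin_two, hs, ht], by simpa using hst, by simp⟩

lemma ConvexFunOn.mono {T : Set (EuclideanSpace ℝ (Fin n))} (h : ConvexFunOn S f) (hTS : T ⊆ S) :
    ConvexFunOn T f :=
  fun k x y w hc hy hx => h k x y w hc (fun i => hTS (hy i)) (hTS hx)

lemma StrictConvexFunOn.mono {T : Set (EuclideanSpace ℝ (Fin n))} (h : StrictConvexFunOn S f)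
    (hTS : T ⊆ S) : StrictConvexFunOn T f :=
  fun k x y w hc hy hx => h k x y w hc (fun i => hTS (hy i)) (hTS hx)

lemma ConvexFunOn.convexOn (h : ConvexFunOn S f) (hS : Convex ℝ S) : ConvexOn ℝ S f := by
  refine ⟨hS, fun x hx y hy s t hs ht hst => ?_⟩
  simpa using h 2 _ _ _ (.two hs ht hst) (by simp [Fin.forall_fin_two, hx, hy])
    (hS hx hy hs ht hst)

lemma StrictConvexFunOn.strictConvexOn (h : StrictConvexFunOn S f) (hS : Convex ℝ S) :
    StrictConvexOn ℝ S f := by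
  refine ⟨hS, fun x hx y hy hxy s t hs ht hst => ?_⟩
  obtain rfl : s = 1 - t := by linarith
  have e₁ : (1 - t) • x + t • y - x = t • (y - x) := by module
  have e₂ : (1 - t) • x + t • y - y = (1 - t) • (x - y) := by module
  have h₁ : x ≠ (1 - t) • x + t • y := fun h => by
    rw [← h, sub_self, eq_comm, smul_eq_zero, sub_eq_zero] at e₁
    exact e₁.elim ht.ne' fun h => hxy h.symm
  have h₂ : y ≠ (1 - t) • x + t • y := fun h => by
    rw [← h, sub_self, eq_comm, smul_eq_zero, sub_eq_zero (a := x)] at e₂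
    exact e₂.elim hs.ne' hxy
  simpa using h 2 _ _ _ (.two hs.le ht.le hst) (by simp [Fin.forall_fin_two, hx, hy])
    (hS hx hy hs.le ht.le hst) (by simpa [Fin.forall_fin_two] using ⟨h₁, h₂⟩)

/-- Points equal to the barycentre may be discarded in Jensen's inequality. -/
lemma ConvexFunOn.of_ne (h : ∀ (k : ℕ) (x : EuclideanSpace ℝ (Fin n))
    (y : Fin k → EuclideanSpace ℝ (Fin n)) (w : Fin k → ℝ), IsConvexCombination x y w →
    (∀ i, y i ∈ S) → x ∈ S → (∀ i, y i ≠ x) → f x ≤ ∑ i, w i * f (y i)) : ConvexFunOn S f := by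
  classical
  rintro k x y w ⟨hw, hw1, hx⟩ hy hxS
  set w₁ : Fin k → ℝ := fun i => if y i = x then 0 else w i with hw₁
  set c := ∑ i, w₁ i with hc
  have hw₁0 : ∀ i, 0 ≤ w₁ i := fun i => by
    simp only [hw₁]; split_ifs; exacts [le_rfl, hw i]
  have hsplit : ∑ i, (w i - w₁ i) = 1 - c := by rw [Finset.sum_sub_distrib, hw1]
  have hf : ∑ i, w i * f (y i) = (1 - c) * f x + ∑ i, w₁ i * f (y i) := by
    rw [← hsplit, Finset.sum_mul, ← Finset.sum_add_distrib]
    refine Finset.sum_congr rfl fun i _ => ?_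
    simp only [hw₁]; split_ifs with hi
    · rw [hi]; ring
    · ring
  have hp : x = (1 - c) • x + ∑ i, w₁ i • y i := by
    conv_lhs => rw [hx]
    rw [← hsplit, Finset.sum_smul, ← Finset.sum_add_distrib]
    refine Finset.sum_congr rfl fun i _ => ?_
    simp only [hw₁]; split_ifs with hi
    · rw [hi]; module
    · module
  rcases (show 0 ≤ c from Finset.sum_nonneg fun i _ => hw₁0 i).eq_or_lt with h0 | hcpos
  · have : ∀ i, w₁ i = 0 := fun i =>
      (Finset.sum_eq_zero_iff_of_nonneg fun i _ => hw₁0 i).1 h0.symm i (Finset.mem_univ i)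
    rw [hf, ← h0]
    simp [this]
  obtain ⟨j, -, hj⟩ := Finset.exists_ne_zero_of_sum_ne_zero hcpos.ne'
  have hjx : y j ≠ x := fun h => hj (by simp [hw₁, h])
  have hcancel : ∀ i, c * (w₁ i / c) = w₁ i := fun i => mul_div_cancel₀ _ hcpos.ne'
  -- The index type is kept: points equal to `x` have weight zero in `w₁` and are replaced by `y j`,
  -- which differs from `x`.
  have key := h k x (fun i => if y i = x then y j else y i) (fun i => w₁ i / c)
    ⟨fun i => div_nonneg (hw₁0 i) hcpos.le, by rw [← Finset.sum_div, div_self hcpos.ne'], ?_⟩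
    (fun i => by split_ifs; exacts [hy j, hy i]) hxS
    (fun i => by split_ifs with hi; exacts [hjx, hi])
  · have key' := mul_le_mul_of_nonneg_left key hcpos.le
    have e : c * ∑ i, w₁ i / c * f (if y i = x then y j else y i) = ∑ i, w₁ i * f (y i) := by
      rw [Finset.mul_sum]
      refine Finset.sum_congr rfl fun i _ => ?_
      rw [← mul_assoc, hcancel]
      split_ifs with hi
      · simp [hw₁, hi]
      · rfl
    rw [e] at key'
    rw [hf]
    linarith
  · have e : c • x = c • ∑ i, (w₁ i / c) • (if y i = x then y j else y i) := by
      have : c • x = ∑ i, w₁ i • y i := by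
        have := sub_eq_iff_eq_add'.2 hp
        rw [← this]; module
      rw [this, Finset.smul_sum]
      refine Finset.sum_congr rfl fun i _ => ?_
      rw [smul_smul, hcancel]
      split_ifs with hi
      · simp [hw₁, hi]
      · rfl
    exact smul_right_injective _ hcpos.ne' e

lemma ConvexFunOn.of_segmentConvexOn {Ω O : Set (EuclideanSpace ℝ (Fin n))} (hΩ : Convex ℝ Ω)
    (hint : CombinationsInRelInterior Ω) (hO : IsOpen O) (hdim : DimLeDimSubTwo (Ω \ O) Ω)
    (hf : SegmentConvexOn (Ω ∩ O) f) : ConvexFunOn (Ω ∩ O) f := by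
  refine ConvexFunOn.of_ne fun k x y w hc hy hxS hne => ?_
  have hx := hint k x y w hc (fun i => (hy i).1) hxS.1 hne
  obtain ⟨hw, hw1, hxw⟩ := hc
  set V := (affineSpan ℝ Ω).direction with hV
  have hxA : x ∈ affineSpan ℝ Ω := subset_affineSpan ℝ Ω hxS.1
  -- In these isometric coordinates on the affine hull, `x` is the origin and relative interior
  -- becomes interior.
  set φ : V → EuclideanSpace ℝ (Fin n) := fun v => (v : EuclideanSpace ℝ (Fin n)) + x with hφ
  have hφi : Isometry φ := (isometry_add_right x).comp isometry_subtype_coe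
  have hφc : ∀ (a b : V) (s t : ℝ), s + t = 1 → φ (s • a + t • b) = s • φ a + t • φ b := by
    intro a b s t hst
    obtain rfl : s = 1 - t := by linarith
    simp only [hφ, Submodule.coe_add, Submodule.coe_smul]
    module
  have hΩ' : Convex ℝ (φ ⁻¹' Ω) := fun a ha b hb s t hs ht hst => by
    rw [mem_preimage, hφc a b s t hst]
    exact hΩ ha hb hs ht hst
  have hB : CodimTwoLe (φ ⁻¹' Ω \ φ ⁻¹' O) := by
    rw [← preimage_sdiff]
    rcases hdim with h | h
    · exact Or.inl (by rw [h, preimage_empty])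
    · refine Or.inr (le_trans ?_ h)
      rw [← hφi.dimH_image]
      gcongr
      exact image_preimage_subset _ _
  have hf' : SegmentConvexOn (φ ⁻¹' Ω ∩ φ ⁻¹' O) (f ∘ φ) := by
    intro a b hab s t hs ht hst
    simp only [Function.comp_apply]
    rw [hφc a b s t hst]
    refine hf _ _ ?_ s t hs ht hst
    rintro _ ⟨p, q, hp, hq, hpq, rfl⟩
    rw [← hφc a b p q hpq]
    exact hab ⟨p, q, hp, hq, hpq, rfl⟩
  have hφy : ∀ p ∈ Ω, ∃ v, φ v = p := fun p hp =>
    ⟨⟨p - x, AffineSubspace.vsub_mem_direction (subset_affineSpan ℝ Ω hp) hxA⟩, by simp [hφ]⟩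
  choose v hv using fun i => hφy (y i) (hy i).1
  have hsum : ∑ i, w i • v i = 0 := by
    have e : φ (∑ i, w i • v i) = φ 0 := by
      simp only [hφ, Submodule.coe_sum, Submodule.coe_smul, Submodule.coe_zero, zero_add]
      have : ∀ i, (v i : EuclideanSpace ℝ (Fin n)) = y i - x := fun i => by
        rw [← hv i]; simp [hφ]
      simp only [this, smul_sub, Finset.sum_sub_distrib, ← Finset.sum_smul, hw1, one_smul, ← hxw]
      simp
    exact hφi.injective e
  have h0 : (0 : V) ∈ interior (φ ⁻¹' Ω) := by
    obtain ⟨p, hp, hpx⟩ := mem_intrinsicInterior.1 hx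
    set ψ : V → affineSpan ℝ Ω := fun u =>
      ⟨φ u, AffineSubspace.vadd_mem_of_mem_direction u.2 hxA⟩ with hψ
    have hψc : Continuous ψ := hφi.continuous.subtype_mk _
    have hp0 : ψ 0 = p := Subtype.ext (by simp [hψ, hφ, hpx])
    have hnhds := hψc.continuousAt (x := 0) (hp0 ▸ mem_interior_iff_mem_nhds.1 hp)
    exact mem_interior_iff_mem_nhds.2 hnhds
  have hφ0 : φ 0 = x := by simp [hφ]
  have := hf'.jensen_of_mem_interior hΩ' (hO.preimage hφi.continuous) hB (y := v)
    (fun i => by simpa only [mem_inter_iff, mem_preimage, hv] using hy i) hw hw1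
    (by rw [hsum]; exact ⟨h0, by rw [mem_preimage, hφ0]; exact hxS.2⟩)
  rw [hsum] at this
  simpa only [Function.comp_apply, hφ0, hv] using this

/-- Contracting the points towards `x` preserves the barycentre and brings them into a ball where
Jensen is strict; convexity then compares the contracted points with the original ones. -/
lemma ConvexFunOn.strict {Ω : Set (EuclideanSpace ℝ (Fin n))} (hΩ : Convex ℝ Ω) (hSΩ : S ⊆ Ω)
    (hf : ConvexFunOn S f)
    (hloc : ∀ x ∈ S, ∃ r > 0, Metric.ball x r ∩ Ω ⊆ S ∧
      StrictConvexOn ℝ (Metric.ball x r ∩ Ω) f) : StrictConvexFunOn S f := by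
  rintro k x y w ⟨hw, hw1, hx⟩ hy hxS hne
  obtain ⟨r, hr, hrS, hstrict⟩ := hloc x hxS
  have hev : ∀ᶠ ε in 𝓝[>] (0 : ℝ), (∀ i, (1 - ε) • x + ε • y i ∈ Metric.ball x r) ∧
      ε ∈ Ioc (0 : ℝ) 1 := by
    refine (eventually_all.2 fun i => ?_).and (Ioc_mem_nhdsGT one_pos)
    have : Tendsto (fun ε : ℝ => (1 - ε) • x + ε • y i) (𝓝 0) (𝓝 x) :=
      Continuous.tendsto' (by fun_prop) _ _ (by simp)
    exact nhdsWithin_le_nhds (this.eventually (Metric.ball_mem_nhds x hr))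
  obtain ⟨ε, hball, hε0, hε1⟩ := hev.exists
  have hz : ∀ i, (1 - ε) • x + ε • y i ∈ Metric.ball x r ∩ Ω := fun i =>
    ⟨hball i, hΩ (hSΩ hxS) (hSΩ (hy i)) (by linarith) hε0.le (by ring)⟩
  have hsum : ∑ i, w i • ((1 - ε) • x + ε • y i) = x := by
    have : ∀ i, w i • ((1 - ε) • x + ε • y i) = w i • ((1 - ε) • x) + ε • (w i • y i) :=
      fun i => by module
    simp only [this, Finset.sum_add_distrib, ← Finset.sum_smul, ← Finset.smul_sum, hw1]
    rw [← hx]; module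
  obtain ⟨j, -, hj⟩ : ∃ j ∈ Finset.univ, w j ≠ 0 :=
    Finset.exists_ne_zero_of_sum_ne_zero (by rw [hw1]; exact one_ne_zero)
  have h1 := (hstrict.map_sum_lt_iff_of_nonneg' (t := Finset.univ) (fun i _ => hw i) hw1
    (fun i _ => hz i)).2 ⟨j, Finset.mem_univ j, hj, fun h => by
      rw [hsum] at h
      have e : ε • (y j - x) = 0 := by
        have : ε • (y j - x) = (1 - ε) • x + ε • y j - x := by module
        rw [this, h, sub_self]
      rw [smul_eq_zero, sub_eq_zero] at e
      exact e.elim hε0.ne' (hne j)⟩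
  rw [hsum] at h1
  -- The segment from `x` to `y i` may leave `S`; `hf` needs only the endpoints and the contracted
  -- point in `S`.
  have h2 : ∀ i, f ((1 - ε) • x + ε • y i) ≤ (1 - ε) * f x + ε * f (y i) := fun i => by
    simpa using hf 2 _ _ _ (.two (by linarith) hε0.le (by ring))
      (by simp [Fin.forall_fin_two, hxS, hy i]) (hrS (hz i))
  have h3 : ∑ i, w i • f ((1 - ε) • x + ε • y i) ≤ ∑ i, w i * ((1 - ε) * f x + ε * f (y i)) :=
    Finset.sum_le_sum fun i _ => mul_le_mul_of_nonneg_left (h2 i) (hw i)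
  have h4 : ∑ i, w i * ((1 - ε) * f x + ε * f (y i)) =
      (1 - ε) * f x + ε * ∑ i, w i * f (y i) := by
    have : ∀ i, w i * ((1 - ε) * f x + ε * f (y i)) =
        w i * ((1 - ε) * f x) + ε * (w i * f (y i)) := fun i => by ring
    simp only [this, Finset.sum_add_distrib, ← Finset.sum_mul, ← Finset.mul_sum, hw1, one_mul]
  have h5 : ε * f x < ε * ∑ i, w i * f (y i) := by linarith
  exact lt_of_mul_lt_mul_left h5 hε0.le

end Transfer

/-! ### The equivalences. -/

theorem mainTheorem8 (n : ℕ) (Ω A : Set (EuclideanSpace ℝ (Fin n)))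
    (hconv : Convex ℝ Ω) (hint : CombinationsInRelInterior Ω)
    (hclosed : IsClosed ((fun p : Ω => (p : EuclideanSpace ℝ (Fin n))) ⁻¹' A))
    (hdim : DimLeDimSubTwo (A ∩ Ω) Ω)
    (f : EuclideanSpace ℝ (Fin n) → ℝ) :
    List.TFAE [ConvexFunOn (Ω \ A) f, LocallyConvexFunOn (Ω \ A) f,
      IntervalConvexFunOn (Ω \ A) f] ∧
    List.TFAE [StrictConvexFunOn (Ω \ A) f, StrictLocallyConvexFunOn (Ω \ A) f,
      StrictIntervalConvexFunOn (Ω \ A) f] := by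
  obtain ⟨O, hO, hOA⟩ := isOpen_induced_iff.1 hclosed.isOpen_compl
  have hmem : ∀ p ∈ Ω, (p ∈ O ↔ p ∉ A) := fun p hp => by
    have := congrArg (fun s : Set Ω => (⟨p, hp⟩ : Ω) ∈ s) hOA
    simpa using this
  have hS : Ω \ A = Ω ∩ O := by
    ext p
    exact and_congr_right fun hp => (hmem p hp).symm
  have hD : A ∩ Ω = Ω \ O := by
    ext p
    rw [inter_comm]
    exact and_congr_right fun hp => by rw [hmem p hp, not_not]
  rw [hD] at hdim
  rw [hS]
  have main : SegmentConvexOn (Ω ∩ O) f → ConvexFunOn (Ω ∩ O) f :=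
    ConvexFunOn.of_segmentConvexOn hconv hint hO hdim
  have hball : ∀ x ∈ Ω ∩ O, ∃ r > 0, Metric.ball x r ∩ Ω ⊆ Ω ∩ O := fun x hx => by
    obtain ⟨r, hr, h⟩ := Metric.isOpen_iff.1 hO x hx.2
    exact ⟨r, hr, fun p hp => ⟨hp.2, h hp.1⟩⟩
  constructor
  · tfae_have 1 → 2 := fun h x _ => ⟨1, one_pos, h.mono inter_subset_right⟩
    tfae_have 1 → 3 := fun h a b hab => h.mono hab
    tfae_have 2 → 1 := fun h => main <| .of_locally fun x hx => by
      obtain ⟨r, hr, hf⟩ := h x hx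
      exact ⟨r, hr, fun C hC hCr => (hf.mono hCr).convexOn hC⟩
    tfae_have 3 → 1 := fun h => main fun a b hab s t hs ht hst =>
      ((h a b hab).convexOn (convex_segment a b)).2 (left_mem_segment ℝ a b)
        (right_mem_segment ℝ a b) hs ht hst
    tfae_finish
  · tfae_have 1 → 2 := fun h x _ => ⟨1, one_pos, h.mono inter_subset_right⟩
    tfae_have 1 → 3 := fun h a b hab => h.mono hab
    tfae_have 2 → 1 := fun h => by
      refine (main <| .of_locally fun x hx => ?_).strict hconv inter_subset_left fun x hx => ?_
      · obtain ⟨r, hr, hf⟩ := h x hx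
        exact ⟨r, hr, fun C hC hCr => ((hf.mono hCr).strictConvexOn hC).convexOn⟩
      · obtain ⟨r, hr, hf⟩ := h x hx
        obtain ⟨r', hr', hsub⟩ := hball x hx
        have hsub' : Metric.ball x (min r r') ∩ Ω ⊆ Metric.ball x r ∩ (Ω ∩ O) := fun p hp =>
          ⟨Metric.ball_subset_ball (min_le_left _ _) hp.1,
            hsub ⟨Metric.ball_subset_ball (min_le_right _ _) hp.1, hp.2⟩⟩
        exact ⟨min r r', lt_min hr hr', hsub'.trans inter_subset_right,
          (hf.mono hsub').strictConvexOn ((convex_ball _ _).inter hconv)⟩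
    tfae_have 3 → 1 := fun h => by
      have h' : ∀ a b, segment ℝ a b ⊆ Ω ∩ O → StrictConvexOn ℝ (segment ℝ a b) f :=
        fun a b hab => (h a b hab).strictConvexOn (convex_segment a b)
      refine (main fun a b hab s t hs ht hst => (h' a b hab).convexOn.2 (left_mem_segment ℝ a b)
        (right_mem_segment ℝ a b) hs ht hst).strict hconv inter_subset_left fun x hx => ?_
      obtain ⟨r, hr, hsub⟩ := hball x hx
      have hC : Convex ℝ (Metric.ball x r ∩ Ω) := (convex_ball _ _).inter hconv
      exact ⟨r, hr, hsub, hC, fun a ha b hb => (h' a b ((hC.segment_subset ha hb).trans hsub)).2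
        (left_mem_segment ℝ a b) (right_mem_segment ℝ a b)⟩
    tfae_finish
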